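/- An abstract $n$-polytope is a partially ordered set with a least and a greatest element in which every maximal chain (flag) has exactly $n+2$ elements, so that its elements (faces) have ranks $-1,0,\dots,n$, and which satisfies the diamond condition (if $F<G$ and $\operatorname{rank}G-\operatorname{rank}F=2$, there are exactly two faces strictly between $F$ and $G$) and strong connectivity (if $F<G$ and $\operatorname{rank}G-\operatorname{rank}F\ge 3$, any two faces strictly between $F$ and $G$ are joined by a finite sequence of faces strictly between $F$ and $G$ in which consecutive faces are comparable). It is regular if its automorphism group (the group of order-automorphisms) acts transitively on the flags; it is chiral if the automorphism group has exactly two orbits on the flags and any two adjacent flags (flags that differ in exactly one face) lie in different orbits. For $0\le k<m\le n-1$, an $n$-polytope is $(k,m)$-flat if every $k$-face is incident with (comparable to) every $m$-face. A polytope $K$ of rank $n$ is a facet of an $(n+1)$-polytope $P$ if $K$ is isomorphic to the section $F/F_{-1}=\{H : F_{-1}\le H\le F\}$ for some $n$-face $F$ of $P$, where $F_{-1}$ is the least face. **Theorem.** Let $n\ge 3$ and let $K$ be a regular $n$-polytope that is $(1,n-1)$-flat. Then no finite chiral $(n+1)$-polytope has $K$ as a facet. -/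

import Mathlib

/-! ### Abstract polytopes

Faces are the elements of a bounded partially ordered set, flags are its maximal chains
(`Flag P`).  When all flags have the same finite length, the rank of a face `F` is
`Order.height F - 1`, where `Order.height F` is the length of a longest chain below `F`
(so the least face `⊥` has rank `-1`). -/

universe u v

namespace AbstractPolytope

/-- `F` is a `k`-face (a face of rank `k ≥ 0`). -/
def IsFace {P : Type u} [PartialOrder P] (k : ℕ) (F : P) : Prop :=
  Order.height F = (k : ℕ∞) + 1

/-- Two faces are incident if they are comparable. -/
def Incident {P : Type u} [PartialOrder P] (F G : P) : Prop :=
  F ≤ G ∨ G ≤ F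

/-- `P` is an abstract `n`-polytope. -/
structure IsPolytope (n : ℕ) (P : Type u) [PartialOrder P] [BoundedOrder P] : Prop where
  /-- Every maximal chain consists of `n + 2` faces (one of each rank `-1, 0, …, n`). -/
  flag_card : ∀ Φ : Flag P, (Φ : Set P).encard = (n : ℕ∞) + 2
  /-- Diamond condition. -/
  diamond : ∀ F G : P, F < G → Order.height G = Order.height F + 2 →
    {H : P | F < H ∧ H < G ∧ Order.height H = Order.height F + 1}.encard = 2
  /-- Strong connectivity: if `F < G` and `rank G - rank F ≥ 3`, then any two faces strictly
  between `F` and `G` are joined by a finite sequence of faces strictly between `F` and `G`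
  in which consecutive faces are incident. -/
  strongly_connected : ∀ F G : P, F < G → Order.height F + 3 ≤ Order.height G →
    ∀ H H' : Set.Ioo F G,
      Relation.ReflTransGen (fun x y : Set.Ioo F G => Incident (x : P) (y : P)) H H'

/-- Two flags are adjacent if they differ in exactly one element. -/
def Adjacent {P : Type u} [PartialOrder P] (Φ Ψ : Flag P) : Prop :=
  ((Φ : Set P) \ (Ψ : Set P)).encard = 1 ∧ ((Ψ : Set P) \ (Φ : Set P)).encard = 1

/-- `P` is a regular `n`-polytope: the automorphism group `P ≃o P` acts transitively on the
flags. -/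
def IsRegular (n : ℕ) (P : Type u) [PartialOrder P] [BoundedOrder P] : Prop :=
  IsPolytope n P ∧ ∀ Φ Ψ : Flag P, ∃ φ : P ≃o P, φ • Φ = Ψ

/-- `P` is a chiral `n`-polytope: the automorphism group `P ≃o P` has exactly two orbits on the
flags, and adjacent flags lie in different orbits. -/
def IsChiral (n : ℕ) (P : Type u) [PartialOrder P] [BoundedOrder P] : Prop :=
  IsPolytope n P ∧
  Nat.card (MulAction.orbitRel.Quotient (P ≃o P) (Flag P)) = 2 ∧
  ∀ Φ Ψ : Flag P, Adjacent Φ Ψ → ¬ ∃ φ : P ≃o P, φ • Φ = Ψ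

/-- `P` is `(k, m)`-flat: every `k`-face is incident with every `m`-face. -/
def IsFlat (k m : ℕ) (P : Type u) [PartialOrder P] : Prop :=
  ∀ F G : P, IsFace k F → IsFace m G → Incident F G

/-- The `(n + 1)`-polytope `P` has `K` as a facet: some section `F / ⊥`, with `F` a face of
rank `n`, is isomorphic to `K`. -/
def HasFacet (n : ℕ) (P : Type u) [PartialOrder P] [BoundedOrder P]
    (K : Type v) [PartialOrder K] : Prop :=
  ∃ F : P, IsFace n F ∧ Nonempty (Set.Icc (⊥ : P) F ≃o K)

end AbstractPolytope

namespace AbstractPolytope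

open Order

/-! ### Levels, rigidity and facet connectivity -/

section Rank

variable {P : Type u} [PartialOrder P]

/-! Suppose such a `P` exists. Every facet of `P` is a copy of `K`, since a facet lies in flags of
both orbits (`IsChiral.nonempty_facet_orderIso`). Flatness says that an edge of a facet lies in
every ridge of that facet, so crossing ridges shows that a fixed edge `E`, with ends `v`, `w`, lies
in every facet (`facet_connected`).

Regularity of `K` gives each facet `F` a reflection swapping `v` and `w` and fixing all faces
between `E` and `F`, hence all ridges of `F`. Automorphisms are determined by their effect on one
flag (`eq_of_fixes_flag`), so the reflections of two facets agree on a common ridge. By connectivity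
they glue to an automorphism of `P` that carries a flag to an adjacent one, which chirality forbids.
-/

theorem Incident.symm {F G : P} (h : Incident F G) : Incident G F := Or.symm h

/-- The height of a face as a natural number, one more than its rank. -/
noncomputable def level (x : P) : ℕ := (height x).toNat

theorem exists_flag_of_incident {A B G H : P} (hG : G ∈ Set.Icc A B) (hH : H ∈ Set.Icc A B)
    (hGH : Incident G H) : ∃ Φ : Flag P, A ∈ Φ ∧ B ∈ Φ ∧ G ∈ Φ ∧ H ∈ Φ := by
  have hAB : A ≤ B := hG.1.trans hG.2
  have hc : IsChain (· ≤ ·) ({A, B, G, H} : Set P) := by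
    refine (((IsChain.singleton).insert ?_).insert ?_).insert ?_
    · rintro x rfl -
      exact hGH
    · rintro x (rfl | rfl) -
      · exact Or.inr hG.2
      · exact Or.inr hH.2
    · rintro x (rfl | rfl | rfl) -
      · exact Or.inl hAB
      · exact Or.inl hG.1
      · exact Or.inl hH.1
  obtain ⟨Φ, hΦ⟩ := hc.exists_subset_flag
  exact ⟨Φ, hΦ (by simp), hΦ (by simp), hΦ (by simp), hΦ (by simp)⟩

variable [BoundedOrder P] {N : ℕ}

namespace IsPolytope

theorem length_le (h : IsPolytope N P) (s : LTSeries P) : s.length ≤ N + 1 := by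
  have hc : IsChain (· ≤ ·) (Set.range s) := by
    rintro _ ⟨i, rfl⟩ _ ⟨j, rfl⟩ -
    rcases le_total i j with hij | hij
    · exact Or.inl (s.monotone hij)
    · exact Or.inr (s.monotone hij)
  obtain ⟨Φ, hΦ⟩ := hc.exists_subset_flag
  have h1 := Set.encard_le_encard hΦ
  rw [h.flag_card, ← Set.image_univ, s.strictMono.injective.encard_image, Set.encard_univ] at h1
  simp only [ENat.card_eq_coe_fintype_card, Fintype.card_fin] at h1
  have : s.length + 1 ≤ N + 2 := by exact_mod_cast h1
  omega

theorem height_le (h : IsPolytope N P) (x : P) : height x ≤ ((N + 1 : ℕ) : ℕ∞) :=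
  Order.height_le fun p _ => by exact_mod_cast h.length_le p

theorem coe_level (h : IsPolytope N P) (x : P) : (level x : ℕ∞) = height x :=
  ENat.natCast_toNat (ne_top_of_le_ne_top (ENat.natCast_ne_top _) (h.height_le x))

theorem level_le (h : IsPolytope N P) (x : P) : level x ≤ N + 1 := by
  have := h.height_le x
  rw [← h.coe_level] at this
  exact_mod_cast this

theorem level_lt (h : IsPolytope N P) {x y : P} (hxy : x < y) : level x < level y := by
  have := height_strictMono hxy (lt_of_le_of_lt (h.height_le x) (ENat.natCast_lt_top _))
  rw [← h.coe_level, ← h.coe_level] at this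
  exact_mod_cast this

theorem level_mono (h : IsPolytope N P) {x y : P} (hxy : x ≤ y) : level x ≤ level y := by
  rcases hxy.eq_or_lt with rfl | hlt
  · exact le_rfl
  · exact (h.level_lt hlt).le

theorem eq_of_le_of_level (h : IsPolytope N P) {x y : P} (hxy : x ≤ y)
    (hl : level y ≤ level x) : x = y := by
  rcases hxy.eq_or_lt with rfl | hlt
  · rfl
  · exact absurd (h.level_lt hlt) (by omega)

theorem le_of_incident (h : IsPolytope N P) {x y : P} (hxy : Incident x y)
    (hl : level x ≤ level y) : x ≤ y :=
  hxy.elim id fun h' => (h.eq_of_le_of_level h' hl).ge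

theorem eq_of_incident (h : IsPolytope N P) {x y : P} (hxy : Incident x y)
    (hl : level x = level y) : x = y :=
  h.eq_of_le_of_level (h.le_of_incident hxy hl.le) hl.ge

theorem eq_of_mem (h : IsPolytope N P) {Φ : Flag P} {x y : P} (hx : x ∈ Φ) (hy : y ∈ Φ)
    (hl : level x = level y) : x = y :=
  h.eq_of_incident (Φ.le_or_le hx hy) hl

theorem le_of_mem (h : IsPolytope N P) {Φ : Flag P} {x y : P} (hx : x ∈ Φ) (hy : y ∈ Φ)
    (hl : level x ≤ level y) : x ≤ y :=
  h.le_of_incident (Φ.le_or_le hx hy) hl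

/-- Counting: `level` is injective on a flag, and the `N + 2` faces of the flag must fill the `N +
2` possible values. -/
theorem exists_mem_level (h : IsPolytope N P) (Φ : Flag P) {k : ℕ} (hk : k ≤ N + 1) :
    ∃ x ∈ Φ, level x = k := by
  have hinj : Set.InjOn level (Φ : Set P) := fun x hx y hy hl => h.eq_of_mem hx hy hl
  have hsub : level '' (Φ : Set P) ⊆ (Finset.range (N + 2) : Set ℕ) := by
    rintro _ ⟨x, -, rfl⟩
    have := h.level_le x
    simp only [Finset.coe_range, Set.mem_Iio]
    omega
  have heq := ((Finset.finite_toSet _).subset hsub).eq_of_subset_of_encard_le hsub (by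
    rw [hinj.encard_image, h.flag_card, Set.encard_coe_eq_coe_finsetCard, Finset.card_range]
    simp)
  have : k ∈ level '' (Φ : Set P) := by
    rw [heq]
    simp only [Finset.coe_range, Set.mem_Iio]
    omega
  exact this

@[simp]
theorem level_bot : level (⊥ : P) = 0 := by simp [level]

theorem level_top (h : IsPolytope N P) : level (⊤ : P) = N + 1 := by
  obtain ⟨Φ⟩ : Nonempty (Flag P) := inferInstance
  obtain ⟨x, -, hx⟩ := h.exists_mem_level Φ le_rfl
  have := h.level_mono (le_top : x ≤ ⊤)
  have := h.level_le (⊤ : P)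
  omega

theorem isFace_iff (h : IsPolytope N P) {k : ℕ} {x : P} : IsFace k x ↔ level x = k + 1 := by
  rw [IsFace, ← h.coe_level]
  norm_cast

theorem level_diamond (h : IsPolytope N P) {A B : P} (hAB : A < B)
    (hl : level B = level A + 2) : (Set.Ioo A B).encard = 2 := by
  rw [← h.diamond A B hAB (by rw [← h.coe_level, ← h.coe_level, hl]; rfl)]
  congr 1
  ext x
  simp only [Set.mem_Ioo, Set.mem_ofPred_eq, ← h.coe_level]
  constructor
  · rintro ⟨h1, h2⟩
    have := h.level_lt h1
    have := h.level_lt h2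
    have : level x = level A + 1 := by omega
    exact ⟨h1, h2, by rw [this]; rfl⟩
  · rintro ⟨h1, h2, -⟩
    exact ⟨h1, h2⟩

/-- An order embedding of an interval into itself that fixes a flag of the interval is the
identity there. -/
theorem eq_of_fixes_flag (h : IsPolytope N P) (d : ℕ) {A B : P} (hAB : A ≤ B)
    (hd : level B ≤ level A + d) {f : P → P}
    (hf : ∀ x ∈ Set.Icc A B, ∀ y ∈ Set.Icc A B, f x ≤ f y ↔ x ≤ y) {Φ : Flag P} (hA : A ∈ Φ)
    (hB : B ∈ Φ) (hΦ : ∀ x ∈ Φ, x ∈ Set.Icc A B → f x = x) : ∀ x ∈ Set.Icc A B, f x = x := by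
  induction d generalizing A B Φ with
  | zero =>
    rintro x ⟨hx1, hx2⟩
    have hAB' := h.eq_of_le_of_level hAB (by omega)
    obtain rfl : A = x := le_antisymm hx1 (hAB' ▸ hx2)
    exact hΦ A hA ⟨hx1, hx2⟩
  | succ d ih =>
    have fA : f A = A := hΦ A hA ⟨le_rfl, hAB⟩
    have fB : f B = B := hΦ B hB ⟨hAB, le_rfl⟩
    suffices hI : ∀ x ∈ Set.Ioo A B, f x = x by
      rintro x ⟨hx1, hx2⟩
      rcases hx1.eq_or_lt with rfl | hx1
      · exact fA
      rcases hx2.eq_or_lt with rfl | hx2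
      · exact fB
      exact hI x ⟨hx1, hx2⟩
    intro x hx
    have hAx := h.level_lt hx.1
    have hxB := h.level_lt hx.2
    obtain ⟨H, hH, hHl⟩ := h.exists_mem_level Φ (k := level A + 1)
      (by have := h.level_le B; omega)
    have hAH : A < H := lt_of_le_of_ne (h.le_of_mem hA hH (by omega)) (by rintro rfl; omega)
    have hHB : H < B := lt_of_le_of_ne (h.le_of_mem hH hB (by omega)) (by rintro rfl; omega)
    have fH : f H = H := hΦ H hH ⟨hAH.le, hHB.le⟩
    -- By the diamond condition the open interval is then a pair, and `f` is injective on it and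
    -- fixes its member `H`.
    by_cases hl : level B = level A + 2
    · have hfx : f x ∈ Set.Ioo A B := by
        constructor
        · rw [← fA]
          exact lt_of_le_not_ge ((hf _ ⟨le_rfl, hAB⟩ _ ⟨hx.1.le, hx.2.le⟩).2 hx.1.le)
            fun h' => hx.1.not_ge ((hf _ ⟨hx.1.le, hx.2.le⟩ _ ⟨le_rfl, hAB⟩).1 h')
        · rw [← fB]
          exact lt_of_le_not_ge ((hf _ ⟨hx.1.le, hx.2.le⟩ _ ⟨hAB, le_rfl⟩).2 hx.2.le)
            fun h' => hx.2.not_ge ((hf _ ⟨hAB, le_rfl⟩ _ ⟨hx.1.le, hx.2.le⟩).1 h')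
      by_cases hxH : x = H
      · rw [hxH, fH]
      have hne : f x ≠ H := fun he => hxH (le_antisymm
        ((hf _ ⟨hx.1.le, hx.2.le⟩ _ ⟨hAH.le, hHB.le⟩).1 (by rw [he, fH]))
        ((hf _ ⟨hAH.le, hHB.le⟩ _ ⟨hx.1.le, hx.2.le⟩).1 (by rw [he, fH])))
      obtain ⟨a, b, -, hab⟩ := Set.encard_eq_two.1 (h.level_diamond (hAH.trans hHB) hl)
      have h1 : H ∈ Set.Ioo A B := ⟨hAH, hHB⟩
      rw [hab] at h1 hfx hx
      simp only [Set.mem_insert_iff, Set.mem_singleton_iff] at h1 hfx hx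
      grind
    -- This property passes to an incident face: a flag through both faces is fixed, and induction
    -- applies to the shorter intervals below and above the new face.
    · let good : P → Prop := fun G => ∀ x ∈ Set.Icc A B, Incident x G → f x = x
      have hstart : good H := by
        rintro y hy (hyH | hHy)
        · exact ih hAH.le (by omega)
            (fun x hx y hy => hf x ⟨hx.1, hx.2.trans hHB.le⟩ y ⟨hy.1, hy.2.trans hHB.le⟩) hA hH
            (fun x hxΦ hx => hΦ x hxΦ ⟨hx.1, hx.2.trans hHB.le⟩) y ⟨hy.1, hyH⟩
        · exact ih hHB.le (by omega)
            (fun x hx y hy => hf x ⟨hAH.le.trans hx.1, hx.2⟩ y ⟨hAH.le.trans hy.1, hy.2⟩) hH hB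
            (fun x hxΦ hx => hΦ x hxΦ ⟨hAH.le.trans hx.1, hx.2⟩) y ⟨hHy, hy.2⟩
      have hstep : ∀ G ∈ Set.Ioo A B, ∀ H ∈ Set.Ioo A B, Incident H G → good H → good G := by
        intro G hG H hH hHG hgood y hy hyG
        have hGl := h.level_lt hG.1
        have hGl' := h.level_lt hG.2
        obtain ⟨Ψ, hAΨ, hBΨ, hGΨ, hHΨ⟩ := exists_flag_of_incident
          (Set.Ioo_subset_Icc_self hG) (Set.Ioo_subset_Icc_self hH) hHG.symm
        have hΨ : ∀ x ∈ Ψ, x ∈ Set.Icc A B → f x = x :=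
          fun x hx hx' => hgood x hx' (Ψ.le_or_le hx hHΨ)
        rcases hyG with hyG | hyG
        · exact ih hG.1.le (by omega)
            (fun x hx y hy => hf x ⟨hx.1, hx.2.trans hG.2.le⟩ y ⟨hy.1, hy.2.trans hG.2.le⟩)
            hAΨ hGΨ (fun x hxΦ hx => hΨ x hxΦ ⟨hx.1, hx.2.trans hG.2.le⟩) y ⟨hy.1, hyG⟩
        · exact ih hG.2.le (by omega)
            (fun x hx y hy => hf x ⟨hG.1.le.trans hx.1, hx.2⟩ y ⟨hG.1.le.trans hy.1, hy.2⟩)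
            hGΨ hBΨ (fun x hxΦ hx => hΨ x hxΦ ⟨hG.1.le.trans hx.1, hx.2⟩) y ⟨hyG, hy.2⟩
      have hconn : ∀ y : Set.Ioo A B, Relation.ReflTransGen
          (fun x y : Set.Ioo A B => Incident (x : P) (y : P)) ⟨H, hAH, hHB⟩ y → good y := by
        intro y hy
        induction hy with
        | refl => exact hstart
        | tail _ hbc ihc => exact hstep _ (Subtype.prop _) _ (Subtype.prop _) hbc ihc
      have hgood := hconn ⟨x, hx⟩ (h.strongly_connected A B (hAH.trans hHB)
        (by rw [← h.coe_level, ← h.coe_level]; exact_mod_cast (by omega)) _ _)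
      exact hgood x ⟨hx.1.le, hx.2.le⟩ (Or.inl le_rfl)

/-- The facets containing a given face are connected through ridges containing it. -/
theorem facet_connected (h : IsPolytope N P) {α : Type*} (c : P → α) (d : ℕ) {G : P}
    (hd : N ≤ level G + d)
    (hc : ∀ F F' H : P, level F = N → level F' = N → level H + 1 = N → G ≤ H → H ≤ F → H ≤ F' →
      c F = c F') {F F' : P} (hF : level F = N) (hF' : level F' = N) (hGF : G ≤ F)
    (hGF' : G ≤ F') : c F = c F' := by
  induction d generalizing G F F' with
  | zero =>
    rw [← h.eq_of_le_of_level hGF (by omega), ← h.eq_of_le_of_level hGF' (by omega)]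
  | succ d ih =>
    have hGl := h.level_mono hGF
    by_cases h0 : level G = N
    · rw [← h.eq_of_le_of_level hGF (by omega), ← h.eq_of_le_of_level hGF' (by omega)]
    by_cases h1 : level G + 1 = N
    · exact hc F F' G hF hF' h1 le_rfl hGF hGF'
    have hlt : ∀ x, level x = N → G ≤ x → x ∈ Set.Ioo G ⊤ := fun x hx hGx =>
      ⟨lt_of_le_of_ne hGx (by rintro rfl; omega),
        lt_of_le_of_ne le_top (by rintro rfl; rw [h.level_top] at hx; omega)⟩
    have hconn := h.strongly_connected G ⊤ ((hlt F hF hGF).1.trans (hlt F hF hGF).2)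
      (by rw [← h.coe_level, ← h.coe_level, h.level_top]; exact_mod_cast (by omega))
      ⟨F, hlt F hF hGF⟩ ⟨F', hlt F' hF' hGF'⟩
    have hfacet : ∀ x : Set.Ioo G ⊤, ∃ y, (x : P) ≤ y ∧ level y = N := by
      rintro ⟨x, hx⟩
      obtain ⟨Φ, hxΦ⟩ := Flag.exists_mem x
      obtain ⟨y, hy, hyl⟩ := h.exists_mem_level Φ (k := N) (by omega)
      have := h.level_lt hx.2
      rw [h.level_top] at this
      exact ⟨y, h.le_of_mem (x := x) hxΦ hy (by omega), hyl⟩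
    have hup : ∀ x : Set.Ioo G ⊤, ∀ y z, level y = N → level z = N → (x : P) ≤ y → (x : P) ≤ z →
        c y = c z := by
      rintro ⟨x, hx⟩ y z hy hz hxy hxz
      have : level G < level x := h.level_lt hx.1
      exact ih (G := x) (by omega)
        (fun F F' H h1 h2 h3 h4 => hc F F' H h1 h2 h3 (hx.1.le.trans h4)) hy hz hxy hxz
    -- Along the path all facets above the current face share the value `c F`. Going up loses facets
    -- only; going down, a facet above the previous face serves for comparison.
    have key : ∀ x : Set.Ioo G ⊤, Relation.ReflTransGen
        (fun x y : Set.Ioo G ⊤ => Incident (x : P) (y : P)) ⟨F, hlt F hF hGF⟩ x →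
        ∀ y, level y = N → (x : P) ≤ y → c F = c y := by
      intro x hx
      induction hx with
      | refl => exact fun y hy hFy => hup _ F y hF hy le_rfl hFy
      | @tail b e _ hbe ihb =>
        intro y hy hey
        rcases hbe with hbe | hbe
        · exact ihb y hy (hbe.trans hey)
        · obtain ⟨z, hz, hzl⟩ := hfacet b
          exact (ihb z hzl hz).trans (hup e z y hzl hy (hbe.trans hz) hey)
    exact key _ hconn F' hF' le_rfl

end IsPolytope

end Rank

/-- The automorphism group of `K` acts transitively on its flags. -/
def FlagTransitive (K : Type u) [PartialOrder K] : Prop :=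
  ∀ Φ Ψ : Flag K, ∃ φ : K ≃o K, φ • Φ = Ψ

theorem FlagTransitive.of_orderIso {K : Type u} {L : Type v} [PartialOrder K] [PartialOrder L]
    (hK : FlagTransitive K) (e : K ≃o L) : FlagTransitive L := by
  intro Φ Ψ
  obtain ⟨φ, hφ⟩ := hK (Flag.map e.symm Φ) (Flag.map e.symm Ψ)
  refine ⟨(e.symm.trans φ).trans e, ?_⟩
  have h1 : φ '' (e.symm '' (Φ : Set L)) = e.symm '' (Ψ : Set L) :=
    congrArg (fun Θ : Flag K => (Θ : Set K)) hφ
  apply Flag.ext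
  change ((e.symm.trans φ).trans e) '' (Φ : Set L) = Ψ
  have h2 : e '' (φ '' (e.symm '' (Φ : Set L))) = Ψ := by
    rw [h1]
    exact e.image_symm_image _
  rw [← h2, Set.image_image, Set.image_image]
  rfl

theorem level_orderIso {P : Type u} {Q : Type v} [PartialOrder P] [PartialOrder Q] (e : P ≃o Q) (x : P) :
    level (e x) = level x := by
  rw [level, level, height_orderIso]

/-! ### Sections below a face -/

section Section

variable {P : Type u} [PartialOrder P] [BoundedOrder P]

theorem height_coe_Icc_bot {F : P} (x : Set.Icc (⊥ : P) F) : height (x : P) = height x :=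
  (height_eq_of_strictMono (Subtype.val : Set.Icc (⊥ : P) F → P) (fun _ _ hxy => hxy)
    (fun a b hb => ⟨⟨b, bot_le, hb.le.trans a.2.2⟩, hb, rfl⟩) x).symm

theorem level_coe_Icc_bot {F : P} (x : Set.Icc (⊥ : P) F) : level (x : P) = level x := by
  rw [level, level, height_coe_Icc_bot]

/-- The flag of the section `F / ⊥` cut out by a flag through `F`. -/
def restrictFlag {F : P} (Φ : Flag P) (hF : F ∈ Φ) : Flag (Set.Icc (⊥ : P) F) :=
  Flag.ofIsMaxChain (Subtype.val ⁻¹' (Φ : Set P)) <| by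
    refine ⟨fun x hx y hy _ => Φ.le_or_le hx hy, fun t ht hst => hst.antisymm fun x hx => ?_⟩
    refine Flag.mem_iff_forall_le_or_ge.2 fun b hb => ?_
    -- A face of the flag not below `F` is above `F`, hence above the whole section.
    rcases Φ.le_or_le hb hF with hbF | hFb
    · exact ht.total hx (hst (show (⟨b, bot_le, hbF⟩ : Set.Icc (⊥ : P) F) ∈ _ from hb))
    · exact Or.inl (x.2.2.trans hFb)

theorem mem_restrictFlag {F : P} {Φ : Flag P} (hF : F ∈ Φ) {x : Set.Icc (⊥ : P) F} :
    x ∈ restrictFlag Φ hF ↔ (x : P) ∈ Φ := Iff.rfl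

/-- An automorphism taking `F` to `G` induces an isomorphism of the sections below them. -/
def sectionIso {F G : P} (g : P ≃o P) (hg : g F = G) :
    Set.Icc (⊥ : P) F ≃o Set.Icc (⊥ : P) G where
  toFun x := ⟨g x, bot_le, hg ▸ g.monotone x.2.2⟩
  invFun x := ⟨g.symm x, bot_le, by
    rw [g.symm_apply_le, hg]
    exact x.2.2⟩
  left_inv x := by simp
  right_inv x := by simp
  map_rel_iff' := g.le_iff_le

end Section

/-! ### Exchanging a vertex; isomorphism of facets -/

namespace IsPolytope

variable {P : Type u} [PartialOrder P] [BoundedOrder P] {N : ℕ}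

theorem adjacent_of_forall_level_ne (h : IsPolytope N P) {k : ℕ} (hk : k ≤ N + 1) {Φ Ψ : Flag P}
    (hΦΨ : ∀ x, level x ≠ k → (x ∈ Φ ↔ x ∈ Ψ)) (hne : Φ ≠ Ψ) : Adjacent Φ Ψ := by
  obtain ⟨v, hv, hvl⟩ := h.exists_mem_level Φ hk
  obtain ⟨w, hw, hwl⟩ := h.exists_mem_level Ψ hk
  have hvw : v ≠ w := by
    rintro rfl
    refine hne (SetLike.ext fun x => ?_)
    by_cases hx : level x = k
    · constructor
      · intro hx'
        rwa [h.eq_of_mem hx' hv (hx.trans hvl.symm)]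
      · intro hx'
        rwa [h.eq_of_mem hx' hw (hx.trans hvl.symm)]
    · exact hΦΨ x hx
  have h1 : (Φ : Set P) \ Ψ = {v} := by
    ext x
    constructor
    · rintro ⟨hx, hx'⟩
      by_cases hxl : level x = k
      · exact h.eq_of_mem hx hv (hxl.trans hvl.symm)
      · exact absurd ((hΦΨ x hxl).1 hx) hx'
    · rintro rfl
      exact ⟨hv, fun hx => hvw (h.eq_of_mem hx hw (hvl.trans hwl.symm))⟩
  have h2 : (Ψ : Set P) \ Φ = {w} := by
    ext x
    constructor
    · rintro ⟨hx, hx'⟩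
      by_cases hxl : level x = k
      · exact h.eq_of_mem hx hw (hxl.trans hwl.symm)
      · exact absurd ((hΦΨ x hxl).2 hx) hx'
    · rintro rfl
      exact ⟨hw, fun hx => hvw (h.eq_of_mem hv hx (hvl.trans hwl.symm))⟩
  exact ⟨by rw [h1, Set.encard_singleton], by rw [h2, Set.encard_singleton]⟩

theorem eq_bot_of_level (h : IsPolytope N P) {x : P} (hx : level x = 0) : x = ⊥ :=
  (h.eq_of_le_of_level bot_le (by simp [hx])).symm

theorem exists_flag_replace_vertex (h : IsPolytope N P) {Φ : Flag P} {E w : P} (hE : E ∈ Φ)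
    (hEl : level E = 2) (hwE : w ≤ E) :
    ∃ Ψ : Flag P, w ∈ Ψ ∧ ∀ x, level x ≠ 1 → (x ∈ Φ ↔ x ∈ Ψ) := by
  have hc : IsChain (· ≤ ·) (insert w {x | x ∈ Φ ∧ E ≤ x}) := by
    refine IsChain.insert (fun x hx y hy _ => Φ.le_or_le hx.1 hy.1) ?_
    rintro x ⟨-, hx⟩ -
    exact Or.inl (hwE.trans hx)
  obtain ⟨Ψ, hΨ⟩ := hc.exists_subset_flag
  have hsub : ∀ x, level x ≠ 1 → x ∈ Φ → x ∈ Ψ := by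
    intro x hxl hx
    by_cases h0 : level x = 0
    · rw [h.eq_bot_of_level h0]
      exact Ψ.bot_mem
    · exact hΨ (Or.inr ⟨hx, h.le_of_mem hE hx (by omega)⟩)
  refine ⟨Ψ, hΨ (Or.inl rfl), fun x hxl => ⟨hsub x hxl, fun hx => ?_⟩⟩
  obtain ⟨y, hy, hyl⟩ := h.exists_mem_level Φ (h.level_le x)
  rwa [h.eq_of_mem hx (hsub y (by omega) hy) hyl.symm]

theorem exists_other_vertex (h : IsPolytope N P) {E : P} (hE : level E = 2) (v : P) :
    ∃ w, w ≠ v ∧ w ≤ E ∧ level w = 1 := by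
  have h2 := h.level_diamond (A := ⊥) (B := E) (bot_lt_iff_ne_bot.2 (by rintro rfl; simp at hE))
    (by simp [hE])
  obtain ⟨w, hw, hwv⟩ := Set.exists_ne_of_one_lt_encard (by rw [h2]; norm_num) v
  refine ⟨w, hwv, hw.2.le, ?_⟩
  have h1 := h.level_lt hw.1
  have h2 := h.level_lt hw.2
  rw [level_bot] at h1
  omega

theorem eq_of_vertices_of_edge (h : IsPolytope N P) {E v w x : P} (hE : level E = 2)
    (hv : level v = 1) (hw : level w = 1) (hx : level x = 1) (hvE : v ≤ E) (hwE : w ≤ E)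
    (hxE : x ≤ E) (hvw : v ≠ w) (hxw : x ≠ w) : x = v := by
  have h2 := h.level_diamond (A := ⊥) (B := E) (bot_lt_iff_ne_bot.2 (by rintro rfl; simp at hE))
    (by simp [hE])
  have hmem : ∀ y, level y = 1 → y ≤ E → y ∈ Set.Ioo ⊥ E := fun y hy hyE =>
    ⟨bot_lt_iff_ne_bot.2 (by rintro rfl; simp at hy), lt_of_le_of_ne hyE (by rintro rfl; omega)⟩
  obtain ⟨a, b, -, hab⟩ := Set.encard_eq_two.1 h2
  have h1 := hmem v hv hvE
  have h3 := hmem w hw hwE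
  have h4 := hmem x hx hxE
  rw [hab] at h1 h3 h4
  simp only [Set.mem_insert_iff, Set.mem_singleton_iff] at h1 h3 h4
  grind

/-- In a polytope with two flag orbits separating adjacent flags, all facets are isomorphic. -/
theorem _root_.AbstractPolytope.IsChiral.nonempty_facet_orderIso (hP : IsChiral N P) (hN : 2 ≤ N)
    {F G : P} (hF : level F = N) (hG : level G = N) :
    Nonempty (Set.Icc (⊥ : P) F ≃o Set.Icc (⊥ : P) G) := by
  obtain ⟨h, hcard, hadj⟩ := hP
  obtain ⟨Φ, hFΦ⟩ := Flag.exists_mem F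
  obtain ⟨Ψ, hGΨ⟩ := Flag.exists_mem G
  -- Exchanging the vertex of `Ψ` keeps `G` and changes the orbit, so one of the two flags lies in
  -- the orbit of `Φ`.
  obtain ⟨E, hE, hEl⟩ := h.exists_mem_level Ψ (k := 2) (by omega)
  obtain ⟨v, hv, hvl⟩ := h.exists_mem_level Ψ (k := 1) (by omega)
  obtain ⟨w, hwv, hwE, hwl⟩ := h.exists_other_vertex hEl v
  obtain ⟨Ψ', hwΨ', hΨ'⟩ := h.exists_flag_replace_vertex hE hEl hwE
  have hne : Ψ ≠ Ψ' := by
    rintro rfl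
    exact hwv (h.eq_of_mem hwΨ' hv (hwl.trans hvl.symm))
  have hGΨ' : G ∈ Ψ' := (hΨ' G (by omega)).1 hGΨ
  have key : ∀ Θ : Flag P, G ∈ Θ → (∃ g : P ≃o P, g • Φ = Θ) →
      Nonempty (Set.Icc (⊥ : P) F ≃o Set.Icc (⊥ : P) G) := by
    rintro Θ hGΘ ⟨g, rfl⟩
    have hgF : g F ∈ g • Φ := Set.mem_image_of_mem g hFΦ
    exact ⟨sectionIso g (h.eq_of_mem hgF hGΘ (by rw [level_orderIso, hF, hG]))⟩
  have horb : ∀ Θ Θ' : Flag P,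
      (Quotient.mk'' Θ : MulAction.orbitRel.Quotient (P ≃o P) (Flag P)) = Quotient.mk'' Θ' →
      ∃ g : P ≃o P, g • Θ = Θ' := by
    intro Θ Θ' hq
    exact MulAction.orbitRel_apply.1 (Quotient.exact hq.symm)
  obtain ⟨a, b, -, hab⟩ := Nat.card_eq_two_iff.1 hcard
  have hmem : ∀ q : MulAction.orbitRel.Quotient (P ≃o P) (Flag P), q = a ∨ q = b := by
    intro q
    have : q ∈ ({a, b} : Set _) := hab ▸ Set.mem_univ q
    exact this
  have hsep := fun hq => hadj _ _ (h.adjacent_of_forall_level_ne (by omega) hΨ' hne) (horb Ψ Ψ' hq)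
  by_cases hq : (Quotient.mk'' Φ : MulAction.orbitRel.Quotient (P ≃o P) (Flag P)) = Quotient.mk'' Ψ
  · exact key Ψ hGΨ (horb _ _ hq)
  · refine key Ψ' hGΨ' (horb _ _ ?_)
    have h1 := hmem (Quotient.mk'' Φ)
    have h2 := hmem (Quotient.mk'' Ψ)
    have h3 := hmem (Quotient.mk'' Ψ')
    grind

end IsPolytope

/-! ### Reflections of facets and their gluing -/

section Reflection

variable {P : Type u} [PartialOrder P] [BoundedOrder P] {N : ℕ}

/-- `f` acts on the section `F / ⊥` as an order embedding that swaps `v` and `w` and fixes every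
face between `E` and `F`. -/
structure IsReflection (E F v w : P) (f : P → P) : Prop where
  apply_le : ∀ x ≤ F, f x ≤ F
  le_iff_le : ∀ x ≤ F, ∀ y ≤ F, f x ≤ f y ↔ x ≤ y
  apply_bot : f ⊥ = ⊥
  apply_left : f v = w
  apply_right : f w = v
  fixes : ∀ x, E ≤ x → x ≤ F → f x = x

/-- Take the automorphism of the section that sends a flag through `v`, `E` to the flag with `v`
exchanged for `w`. It fixes a flag of `[E, F]`, so by rigidity all of it. -/
theorem IsPolytope.exists_isReflection (h : IsPolytope N P) {E F v w : P} (hE : level E = 2)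
    (hv : level v = 1) (hw : level w = 1) (hvw : v ≠ w) (hvE : v ≤ E) (hwE : w ≤ E) (hEF : E ≤ F)
    (htrans : FlagTransitive (Set.Icc (⊥ : P) F)) : ∃ f, IsReflection E F v w f := by
  classical
  obtain ⟨Φ, hvΦ, hFΦ, hEΦ, -⟩ := exists_flag_of_incident (A := v) (B := F) (G := E)
    (H := E) ⟨hvE, hEF⟩ ⟨hvE, hEF⟩ (Or.inl le_rfl)
  obtain ⟨Ψ, hwΨ, hΨ⟩ := h.exists_flag_replace_vertex hEΦ hE hwE
  have hEFl := h.level_mono hEF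
  have hFΨ : F ∈ Ψ := (hΨ F (by omega)).1 hFΦ
  obtain ⟨φ, hφ⟩ := htrans (restrictFlag Φ hFΦ) (restrictFlag Ψ hFΨ)
  let f : P → P := fun x => if hx : x ≤ F then φ ⟨x, bot_le, hx⟩ else x
  have hf : ∀ x (hx : x ≤ F), f x = φ ⟨x, bot_le, hx⟩ := fun x hx => dif_pos hx
  have hle : ∀ x ≤ F, f x ≤ F := fun x hx => by
    rw [hf x hx]
    exact (φ _).2.2
  have hiff : ∀ x ≤ F, ∀ y ≤ F, f x ≤ f y ↔ x ≤ y := fun x hx y hy => by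
    rw [hf x hx, hf y hy]
    exact φ.le_iff_le
  have hlev : ∀ x ≤ F, level (f x) = level x := fun x hx => by
    rw [hf x hx, level_coe_Icc_bot, level_orderIso, ← level_coe_Icc_bot]
  have hmem : ∀ x ∈ Φ, x ≤ F → f x ∈ Ψ := fun x hx hxF => by
    rw [hf x hxF, ← mem_restrictFlag hFΨ, ← hφ]
    exact Set.mem_image_of_mem φ (show (⟨x, bot_le, hxF⟩ : Set.Icc (⊥ : P) F) ∈ _ from hx)
  have hfv : f v = w := h.eq_of_mem (hmem v hvΦ (hvE.trans hEF)) hwΨ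
    (by rw [hlev v (hvE.trans hEF), hv, hw])
  have hfix : ∀ x ∈ Set.Icc E F, f x = x := by
    refine h.eq_of_fixes_flag N hEF (by have := h.level_le F; omega)
      (fun x hx y hy => hiff x hx.2 y hy.2) hEΦ hFΦ fun x hx hx' => ?_
    have := h.level_mono hx'.1
    exact h.eq_of_mem (hmem x hx hx'.2) ((hΨ x (by omega)).1 hx) (hlev x hx'.2)
  refine ⟨f, hle, hiff, ?_, hfv, ?_, fun x hx hx' => hfix x ⟨hx, hx'⟩⟩
  · exact h.eq_bot_of_level (by rw [hlev _ bot_le, level_bot])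
  · have hwF := hwE.trans hEF
    -- `f w` is an end of `E`, and it is not `w = f v` by injectivity.
    refine h.eq_of_vertices_of_edge hE hv hw (by rw [hlev w hwF, hw]) hvE hwE ?_ hvw ?_
    · rw [← hfix E ⟨le_rfl, hEF⟩, hiff w hwF E hEF]
      exact hwE
    · intro he
      refine hvw (h.eq_of_le_of_level ((hiff v (hvE.trans hEF) w hwF).1 (by rw [hfv, he])) ?_)
      omega

/-- The composite fixes `⊥`, `v` and all faces from `E` to `H`, thus a flag of the section below
`H`; rigidity applies. -/
theorem IsReflection.apply_apply (h : IsPolytope N P) {E F F' v w : P} {f f' : P → P}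
    (hf : IsReflection E F v w f) (hf' : IsReflection E F' v w f') (hE : level E = 2)
    (hv : level v = 1) (hvE : v ≤ E) {H : P} (hEH : E ≤ H) (hHF : H ≤ F) (hHF' : H ≤ F') :
    ∀ x ≤ H, f' (f x) = x := by
  have hfH : ∀ x ≤ H, f x ≤ H := fun x hx => by
    rw [← hf.fixes H hEH hHF, hf.le_iff_le x (hx.trans hHF) H hHF]
    exact hx
  obtain ⟨Φ, hvΦ, hHΦ, hEΦ, -⟩ := exists_flag_of_incident (A := v) (B := H) (G := E)
    (H := E) ⟨hvE, hEH⟩ ⟨hvE, hEH⟩ (Or.inl le_rfl)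
  have key := h.eq_of_fixes_flag (N + 1) (f := fun x => f' (f x)) (bot_le : ⊥ ≤ H)
    (by have := h.level_le H; omega) (fun x hx y hy => by
      rw [hf'.le_iff_le _ ((hfH x hx.2).trans hHF') _ ((hfH y hy.2).trans hHF'),
        hf.le_iff_le _ (hx.2.trans hHF) _ (hy.2.trans hHF)]) Φ.bot_mem hHΦ ?_
  · exact fun x hx => key x ⟨bot_le, hx⟩
  · rintro x hx ⟨-, hxH⟩
    by_cases h0 : level x = 0
    · rw [h.eq_bot_of_level h0, hf.apply_bot, hf'.apply_bot]
    by_cases h1 : level x = 1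
    · rw [h.eq_of_mem hx hvΦ (by omega), hf.apply_left, hf'.apply_right]
    · have hEx := h.le_of_mem hEΦ hx (by omega)
      rw [hf.fixes x hEx (hxH.trans hHF), hf'.fixes x hEx (hxH.trans hHF')]

/-- Below `H`, both `f' ∘ f` and `f' ∘ f'` are the identity. -/
theorem IsReflection.eq_of_le (h : IsPolytope N P) {E F F' v w : P} {f f' : P → P}
    (hf : IsReflection E F v w f) (hf' : IsReflection E F' v w f') (hE : level E = 2)
    (hv : level v = 1) (hvE : v ≤ E) {H : P} (hEH : E ≤ H) (hHF : H ≤ F) (hHF' : H ≤ F') :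
    ∀ x ≤ H, f x = f' x := by
  intro x hx
  have hfx : f x ≤ H := by
    rw [← hf.fixes H hEH hHF, hf.le_iff_le x (hx.trans hHF) H hHF]
    exact hx
  have h1 := hf'.apply_apply h hf' hE hv hvE hEH hHF' hHF' _ hfx
  rw [hf.apply_apply h hf' hE hv hvE hEH hHF hHF' x hx] at h1
  exact h1.symm

/-- A polytope with flag-transitive facets in which every edge of a facet lies in every ridge of
that facet has an automorphism carrying some flag to an adjacent one. -/
theorem IsPolytope.exists_adjacent_smul (h : IsPolytope N P) (hN : 4 ≤ N)
    (htrans : ∀ F : P, level F = N → FlagTransitive (Set.Icc (⊥ : P) F))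
    (hflat : ∀ E H F : P, level E = 2 → level H + 1 = N → level F = N → E ≤ F → H ≤ F → E ≤ H) :
    ∃ Φ Ψ : Flag P, Adjacent Φ Ψ ∧ ∃ ρ : P ≃o P, ρ • Φ = Ψ := by
  classical
  obtain ⟨Φ⟩ : Nonempty (Flag P) := inferInstance
  obtain ⟨F₀, hF₀, hF₀l⟩ := h.exists_mem_level Φ (k := N) (by omega)
  obtain ⟨E, hEΦ, hE⟩ := h.exists_mem_level Φ (k := 2) (by omega)
  obtain ⟨v, hvΦ, hv⟩ := h.exists_mem_level Φ (k := 1) (by omega)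
  have hvE : v ≤ E := h.le_of_mem hvΦ hEΦ (by omega)
  obtain ⟨w, hwv, hwE, hw⟩ := h.exists_other_vertex hE v
  have hEF : ∀ F, level F = N → E ≤ F := by
    intro F hF
    have := h.facet_connected (fun F => E ≤ F) N (G := ⊥) (by simp)
      (fun F F' H hF hF' hH _ hHF hHF' => propext
        ⟨fun hEF => (hflat E H F hE hH hF hEF hHF).trans hHF',
          fun hEF => (hflat E H F' hE hH hF' hEF hHF').trans hHF⟩) hF₀l hF bot_le bot_le
    exact this.mp (h.le_of_mem hEΦ hF₀ (by omega))
  have hfacet : ∀ x : P, x ≠ ⊤ → ∃ F, level F = N ∧ x ≤ F := by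
    intro x hx
    obtain ⟨Θ, hxΘ⟩ := Flag.exists_mem x
    obtain ⟨y, hy, hyl⟩ := h.exists_mem_level Θ (k := N) (by omega)
    have := h.level_lt (lt_top_iff_ne_top.2 hx)
    rw [h.level_top] at this
    exact ⟨y, hyl, h.le_of_mem hxΘ hy (by omega)⟩
  have hne_top : ∀ F x : P, level F = N → x ≤ F → x ≠ ⊤ := by
    rintro F x hF hx rfl
    have := h.level_mono hx
    rw [h.level_top] at this
    omega
  choose f hf using fun F : {F : P // level F = N} =>
    h.exists_isReflection hE hv hw hwv.symm hvE hwE (hEF F F.2) (htrans F F.2)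
  let c : P → P → P := fun F => if hF : level F = N then f ⟨F, hF⟩ else id
  have hcF : ∀ F, level F = N → IsReflection E F v w (c F) := fun F hF => by
    simp only [c, dif_pos hF]
    exact hf ⟨F, hF⟩
  have hcc : ∀ x F F', level F = N → level F' = N → x ≤ F → x ≤ F' → c F x = c F' x := by
    intro x F F' hF hF' hxF hxF'
    -- Flatness puts `E` below the ridge shared by two neighbouring facets, which is what agreement
    -- on that ridge needs.
    exact h.facet_connected (fun F => c F x) N (G := x) (by omega)
      (fun F F' H hF hF' hH hxH hHF hHF' => (hcF F hF).eq_of_le h (hcF F' hF') hE hv hvE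
        (hflat E H F hE hH hF (hEF F hF) hHF) hHF hHF' x hxH) hF hF' hxF hxF'
  choose! m hm hm' using hfacet
  -- The glued map: the choice of facet `m x` is immaterial by `hcc`, and only `⊤` lies in no facet.
  let r : P → P := fun x => if x = ⊤ then ⊤ else c (m x) x
  have hr : ∀ F x, level F = N → x ≤ F → r x = c F x := fun F x hF hx => by
    have hx' := hne_top F x hF hx
    simp only [r, if_neg hx']
    exact hcc x _ _ (hm x hx') hF (hm' x hx') hx
  have hr_top : r ⊤ = ⊤ := if_pos rfl
  have hrr : ∀ x, r (r x) = x := by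
    intro x
    by_cases hx : x = ⊤
    · rw [hx, hr_top, hr_top]
    · have hF := hm x hx
      have hxF := hm' x hx
      rw [hr _ x hF hxF, hr _ _ hF ((hcF _ hF).apply_le x hxF)]
      exact (hcF _ hF).apply_apply h (hcF _ hF) hE hv hvE (hEF _ hF) le_rfl le_rfl x hxF
  have hmono : ∀ x y, x ≤ y → r x ≤ r y := by
    intro x y hxy
    by_cases hy : y = ⊤
    · rw [hy, hr_top]
      exact le_top
    · have hF := hm y hy
      have hyF := hm' y hy
      rw [hr _ x hF (hxy.trans hyF), hr _ y hF hyF,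
        (hcF _ hF).le_iff_le _ (hxy.trans hyF) _ hyF]
      exact hxy
  let ρ : P ≃o P :=
    { toFun := r
      invFun := r
      left_inv := hrr
      right_inv := hrr
      map_rel_iff' := by
        intro x y
        refine ⟨fun hxy => ?_, hmono x y⟩
        simpa only [hrr] using hmono _ _ (show r x ≤ r y from hxy) }
  have hρv : ρ v = w := (hr F₀ v hF₀l (hvE.trans (hEF F₀ hF₀l))).trans (hcF F₀ hF₀l).apply_left
  have hρfix : ∀ x ∈ Φ, level x ≠ 1 → ρ x = x := by
    intro x hx hxl
    by_cases h0 : level x = 0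
    · rw [h.eq_bot_of_level h0, map_bot]
    by_cases hxt : x = ⊤
    · rw [hxt, map_top]
    · exact (hr _ x (hm x hxt) (hm' x hxt)).trans ((hcF _ (hm x hxt)).fixes x
        (h.le_of_mem hEΦ hx (by omega)) (hm' x hxt))
  refine ⟨Φ, ρ • Φ, h.adjacent_of_forall_level_ne (k := 1) (by omega) ?_ ?_, ρ, rfl⟩
  · intro x hxl
    constructor
    · intro hx
      exact ⟨x, hx, hρfix x hx hxl⟩
    · rintro ⟨y, hy, rfl⟩
      have hyl : level y ≠ 1 := by rwa [← level_orderIso ρ y]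
      change ρ y ∈ Φ
      rwa [hρfix y hy hyl]
  · intro he
    have hwΦ : w ∈ Φ := by
      rw [he]
      exact ⟨v, hvΦ, hρv⟩
    exact hwv (h.eq_of_mem hwΦ hvΦ (hw.trans hv.symm))

end Reflection

end AbstractPolytope

/-! ### The main theorem -/

open AbstractPolytope in
theorem mainTheorem3 (n : ℕ) (hn : 3 ≤ n)
    (K : Type u) [PartialOrder K] [BoundedOrder K]
    (hK : AbstractPolytope.IsRegular n K)
    (hflat : AbstractPolytope.IsFlat 1 (n - 1) K)
    (P : Type v) [PartialOrder P] [BoundedOrder P] [Finite P]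
    (hP : AbstractPolytope.IsChiral (n + 1) P) :
    ¬ AbstractPolytope.HasFacet n P K := by
  rintro ⟨F₀, hF₀, ⟨e⟩⟩
  have h := hP.1
  rw [h.isFace_iff] at hF₀
  have hiso : ∀ F : P, level F = n + 1 → Nonempty (Set.Icc (⊥ : P) F ≃o K) := fun F hF =>
    (hP.nonempty_facet_orderIso (by omega) hF hF₀).map fun e' => e'.trans e
  obtain ⟨Φ, Ψ, hadj, hρ⟩ := h.exists_adjacent_smul (by omega)
    (fun F hF => by
      obtain ⟨e'⟩ := hiso F hF
      exact FlagTransitive.of_orderIso hK.2 e'.symm)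
    (fun E H F hE hH hF hEF hHF => by
      obtain ⟨e'⟩ := hiso F hF
      have hEK := level_orderIso e' ⟨E, bot_le, hEF⟩
      have hHK := level_orderIso e' ⟨H, bot_le, hHF⟩
      rw [← level_coe_Icc_bot] at hEK hHK
      -- Levels exceed ranks by one and survive passage to the section, so `E` and `H` correspond to
      -- a 1-face and an `(n - 1)`-face of `K`.
      have hEH := hflat _ _ (hK.1.isFace_iff.2 (hEK.trans hE))
        (hK.1.isFace_iff.2 (hHK.trans (show level H = n - 1 + 1 by omega)))
      exact h.le_of_incident (x := E) (y := H) (hEH.imp e'.le_iff_le.1 e'.le_iff_le.1) (by omega))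
  exact hP.2.2 Φ Ψ hadj hρ
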